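/- Let $K$ be an oriented polygonal knot in $\mathbb{R}^3$ whose projection to the $xy$-plane is regular, i.e. finitely many points of the plane are images of more than one point of $K$ (the crossings), each of them is the image of exactly two points of $K$, and none of them is the image of a vertex; let $D$ be the resulting diagram. Breaking $K$ at the lower point of every crossing gives the strands of $D$; let $D$ have $n$ strands. Assume that $D$ is alternating (travelling along $K$, passages over and under crossings alternate) and reduced (no crossing can be removed by a twist move, i.e. there is no crossing $c$ such that one of the two arcs of $K$ from $c$ to $c$ contains no other crossing; in particular this holds if $D$ has no nugatory crossing). Let $M(T)$ be the matrix over $\mathbb{Z}[T,T^{-1}]$ with one row for each crossing and one column for each strand in which, in the row of a crossing, the overstrand has entry $1-T$, the understrand to the left of the overstrand has entry $-1$, the understrand to the right has entry $T$, and all other strands have entry $0$ (entries are added if these strands coincide). Let the Alexander polynomial $\Delta_K(T)\in\mathbb{Z}[T]$ be the generator with positive constant term of the ideal of $\mathbb{Z}[T,T^{-1}]$ generated by the $(n-1)\times(n-1)$ minors of $M(T)$, and suppose that the determinant $|\Delta_K(-1)|$ of $K$ is a prime number $p$. Then the knot code $\mathcal{C}_D=\{x\in\mathbb{F}_p^n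 : M(-1)x^\top=0\}$, whose elements are the Fox $(\mathbb{F}_p,-1)$-colorings of $D$, is an $[n,2,n-1]_p$ code: it has length $n$, dimension $2$ and minimum Hamming distance $n-1$. In particular it is MDS, i.e. dimension plus minimum distance equals $n+1$. -/

import Mathlib

open scoped LaurentPolynomial Polynomial

noncomputable section

/-! ### Oriented polygonal knots -/

/-- The point at time `t` of the closed polygon with cyclically ordered vertices `v`: at integer
times the polygon is at its vertices, and in between it moves along the edges at constant speed.
The map is periodic with period `m`. -/
def polygonPoint {m : ℕ} (v : ZMod m → EuclideanSpace ℝ (Fin 3)) (t : ℝ) :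
    EuclideanSpace ℝ (Fin 3) :=
  (1 - Int.fract t) • v (⌊t⌋ : ℤ) + Int.fract t • v ((⌊t⌋ : ℤ) + 1)

/-- An oriented polygonal knot in space: a closed polygon without self-intersections.
The orientation is the cyclic order of the vertices. -/
structure PolygonalKnot where
  /-- the number of vertices -/
  m : ℕ
  three_le : 3 ≤ m
  vertex : ZMod m → EuclideanSpace ℝ (Fin 3)
  /-- one tour of the polygon meets no point twice -/
  simple : Set.InjOn (polygonPoint vertex) (Set.Ico (0 : ℝ) m)

namespace PolygonalKnot

variable (K : PolygonalKnot)

/-- The parameters of one tour of the knot; they correspond bijectively to its points. -/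
def params : Set ℝ := Set.Ico (0 : ℝ) K.m

/-- The parametrization of the knot. -/
def point (t : ℝ) : EuclideanSpace ℝ (Fin 3) := polygonPoint K.vertex t

/-- The knot as a subset of space. -/
def carrier : Set (EuclideanSpace ℝ (Fin 3)) := K.point '' K.params

/-- The projection of the knot to the plane, `(x, y, z) ↦ (x, y)`. -/
def shadow (t : ℝ) : ℝ × ℝ := (K.point t 0, K.point t 1)

/-- The height above the plane. -/
def height (t : ℝ) : ℝ := K.point t 2

/-- The edge, as a vector, along which the knot travels at time `t`. -/
def edgeVector (t : ℝ) : EuclideanSpace ℝ (Fin 3) :=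
  K.vertex ((⌊t⌋ : ℤ) + 1) - K.vertex (⌊t⌋ : ℤ)

/-- The points of the plane over which there is more than one point of the knot. -/
def crossingPoints : Set (ℝ × ℝ) :=
  {Q | ∃ s ∈ K.params, ∃ t ∈ K.params, s ≠ t ∧ K.shadow s = Q ∧ K.shadow t = Q}

/-- The projection is regular: there are finitely many points of intersection, each of them is the
image of exactly two points of the knot, and none of them is the image of a vertex. -/
structure IsRegular : Prop where
  finite : K.crossingPoints.Finite
  double : ∀ Q ∈ K.crossingPoints, {t ∈ K.params | K.shadow t = Q}.ncard = 2
  vertex : ∀ k : ℕ, k < K.m → K.shadow k ∉ K.crossingPoints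

/-- `t` is a parameter at which the knot passes through a crossing. -/
def IsPassage (t : ℝ) : Prop := t ∈ K.params ∧ K.shadow t ∈ K.crossingPoints

/-- The knot passes over itself at time `t`. -/
def IsOver (t : ℝ) : Prop :=
  t ∈ K.params ∧ ∃ s ∈ K.params, K.shadow s = K.shadow t ∧ K.height s < K.height t

/-- The knot passes under itself at time `t`. -/
def IsUnder (t : ℝ) : Prop :=
  t ∈ K.params ∧ ∃ s ∈ K.params, K.shadow s = K.shadow t ∧ K.height t < K.height s

/-- The time needed to travel from parameter `a` along the orientation until parameter `b` is
reached (a full tour if `a = b`). -/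
def travel (a b : ℝ) : ℝ := if a < b then b - a else b - a + K.m

theorem heights_ne {s t : ℝ} (hs : s ∈ K.params) (ht : t ∈ K.params) (hne : s ≠ t)
    (h : K.shadow s = K.shadow t) : K.height s ≠ K.height t := by
  intro hz
  refine hne (K.simple hs ht ?_)
  simp only [shadow, Prod.mk.injEq] at h
  ext i
  fin_cases i
  · exact h.1
  · exact h.2
  · exact hz

end PolygonalKnot

/-! ### Knot diagrams: crossings and strands -/

/-- A diagram of an oriented polygonal knot: the knot together with the fact that its projection
is regular. The over/under information of the diagram is read off from the heights. -/
structure KnotDiagram extends PolygonalKnot where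
  regular : toPolygonalKnot.IsRegular

namespace KnotDiagram

variable (D : KnotDiagram)

/-- The crossings of the diagram. -/
def Crossing : Type := D.toPolygonalKnot.crossingPoints

instance : Fintype D.Crossing := D.regular.finite.fintype

instance : DecidableEq D.Crossing := Classical.decEq _

theorem exists_over_under (c : D.Crossing) :
    ∃ ou : ℝ × ℝ, ou.1 ∈ D.params ∧ ou.2 ∈ D.params ∧
      D.shadow ou.1 = c.1 ∧ D.shadow ou.2 = c.1 ∧ D.height ou.2 < D.height ou.1 := by
  obtain ⟨s, hs, t, ht, hne, h1, h2⟩ := c.2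
  rcases lt_or_gt_of_ne (D.heights_ne hs ht hne (h1.trans h2.symm)) with h | h
  · exact ⟨(t, s), ht, hs, h2, h1, h⟩
  · exact ⟨(s, t), hs, ht, h1, h2, h⟩

/-- The parameter of the upper one of the two points of the knot over a crossing. -/
def overTime (c : D.Crossing) : ℝ := (D.exists_over_under c).choose.1

/-- The parameter of the lower one of the two points of the knot over a crossing. -/
def underTime (c : D.Crossing) : ℝ := (D.exists_over_under c).choose.2

/-- Breaking the knot at the lower point of every crossing yields the strands. Every strand starts
at exactly one crossing (as soon as there are crossings at all), so the strands are labelled by the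
crossing at which they start, following the orientation. -/
abbrev Strand : Type := D.Crossing

/-- The point with parameter `t` lies on the strand `x`: it is passed after the start of the strand
and before the next passage under a crossing. -/
def OnStrand (x : D.Strand) (t : ℝ) : Prop :=
  t ∈ D.params ∧ ∀ c : D.Crossing,
    D.travel (D.underTime x) t < D.travel (D.underTime x) (D.underTime c)

/-- The strand `x` as a subset of the knot. -/
def strandArc (x : D.Strand) : Set (EuclideanSpace ℝ (Fin 3)) := D.point '' {t | D.OnStrand x t}

/-- If there are crossings, every point of the knot that does not pass under another one lies on
exactly one strand. -/
theorem existsUnique_strand [Nonempty D.Crossing] {t : ℝ} (ht : t ∈ D.params)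
    (hu : ¬ D.IsUnder t) : ∃! x : D.Strand, D.OnStrand x t := by
  have spec := fun c : D.Crossing => (D.exists_over_under c).choose_spec
  have mem : ∀ c : D.Crossing, D.underTime c ∈ D.params := fun c => (spec c).2.1
  have ne : ∀ c : D.Crossing, D.underTime c ≠ t := fun c h =>
    hu (h ▸ ⟨mem c, _, (spec c).1, (spec c).2.2.1.trans (spec c).2.2.2.1.symm, (spec c).2.2.2.2⟩)
  have inj : ∀ c c' : D.Crossing, D.underTime c = D.underTime c' → c = c' := fun c c' h =>
    Subtype.ext ((spec c).2.2.2.1.symm.trans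
      ((congrArg D.shadow h).trans (spec c').2.2.2.1))
  obtain ⟨x, -, hx⟩ := Finset.exists_min_image Finset.univ
    (fun c : D.Crossing => D.travel (D.underTime c) t) Finset.univ_nonempty
  refine ⟨x, ⟨ht, fun c => ?_⟩, fun y hy => ?_⟩
  · have h1 := hx c (Finset.mem_univ c)
    have hx0 := (mem x).1
    have hxm := (mem x).2
    have hc0 := (mem c).1
    have hcm := (mem c).2
    have ht0 := ht.1
    have htm := ht.2
    rcases lt_or_gt_of_ne (ne c) with h2 | h2 <;> rcases lt_or_gt_of_ne (ne x) with h3 | h3 <;>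
      simp only [PolygonalKnot.travel] at h1 ⊢ <;> split_ifs at h1 ⊢ <;> linarith
  · by_contra hxy
    have h1 := hx y (Finset.mem_univ y)
    have h2 := hy.2 x
    have hx0 := (mem x).1
    have hxm := (mem x).2
    have hy0 := (mem y).1
    have hym := (mem y).2
    have ht0 := ht.1
    have htm := ht.2
    have h5 : D.underTime y ≠ D.underTime x := fun h => hxy (inj _ _ h)
    rcases lt_or_gt_of_ne h5 with h5 | h5 <;> rcases lt_or_gt_of_ne (ne y) with h4 | h4 <;>
      rcases lt_or_gt_of_ne (ne x) with h3 | h3 <;>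
      simp only [PolygonalKnot.travel] at h1 h2 <;> split_ifs at h1 h2 <;> linarith

/-- `x` is the overstrand at the crossing `c`. -/
def IsOverstrand (x : D.Strand) (c : D.Crossing) : Prop := D.OnStrand x (D.overTime c)

/-- `x` is the understrand that leaves the crossing `c`. -/
def IsOutgoing (x : D.Strand) (c : D.Crossing) : Prop := x = c

/-- `x` is the understrand that arrives at the crossing `c`, i.e. the first passage under a
crossing after the start of `x` is the one at `c`. -/
def IsIncoming (x : D.Strand) (c : D.Crossing) : Prop :=
  ∀ c' : D.Crossing, D.travel (D.underTime x) (D.underTime c) ≤ D.travel (D.underTime x) (D.underTime c')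

/-- At `c` the lower branch of the knot crosses the upper branch from right to left, as seen when
following the upper branch along the orientation. -/
def RightToLeft (c : D.Crossing) : Prop :=
  0 < D.edgeVector (D.overTime c) 0 * D.edgeVector (D.underTime c) 1
    - D.edgeVector (D.overTime c) 1 * D.edgeVector (D.underTime c) 0

/-- `x` is an understrand at `c` at the left side of the overstrand. -/
def IsLeftUnderstrand (x : D.Strand) (c : D.Crossing) : Prop :=
  (D.RightToLeft c ∧ D.IsOutgoing x c) ∨ (¬ D.RightToLeft c ∧ D.IsIncoming x c)

/-- `x` is an understrand at `c` at the right side of the overstrand. -/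
def IsRightUnderstrand (x : D.Strand) (c : D.Crossing) : Prop :=
  (D.RightToLeft c ∧ D.IsIncoming x c) ∨ (¬ D.RightToLeft c ∧ D.IsOutgoing x c)

/-- The diagram is alternating: of any two consecutive passages through crossings, one is a passage
over and the other one is a passage under. -/
def IsAlternating : Prop :=
  ∀ s t : ℝ, D.IsPassage s → D.IsPassage t →
    (∀ r : ℝ, D.IsPassage r → D.travel s t ≤ D.travel s r) →
      (D.IsOver s ∧ D.IsUnder t) ∨ (D.IsUnder s ∧ D.IsOver t)

/-- The crossing `c` can be removed by a twist (first Reidemeister) move: one of the two arcs of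
the knot from `c` to `c` runs through no crossing on its way. -/
def IsKink (c : D.Crossing) : Prop :=
  (∀ t : ℝ, D.IsPassage t → D.travel (D.overTime c) (D.underTime c) ≤ D.travel (D.overTime c) t) ∨
  (∀ t : ℝ, D.IsPassage t → D.travel (D.underTime c) (D.overTime c) ≤ D.travel (D.underTime c) t)

/-- The diagram is reduced: no crossing can be removed by a twist move. -/
def IsReduced : Prop := ∀ c : D.Crossing, ¬ D.IsKink c

end KnotDiagram

/-! ### The Alexander matrix and the Alexander polynomial -/

/-- The `k`-th elementary (Fitting) ideal of a matrix with `n` columns: the ideal generated by the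
minors of size `n - k`. It is the unit ideal for `k ≥ n` (the empty minor is `1`), and zero if there
are fewer than `n - k` rows. -/
def elementaryIdeal {R ι κ : Type*} [CommRing R] [Fintype κ] (k : ℕ) (A : Matrix ι κ R) :
    Ideal R :=
  Ideal.span {d | ∃ (f : Fin (Fintype.card κ - k) ↪ ι) (g : Fin (Fintype.card κ - k) ↪ κ),
    d = (A.submatrix f g).det}

namespace KnotDiagram

variable (D : KnotDiagram)

open Classical in
/-- The Alexander (Fox coloring) matrix. Its rows belong to the crossings, its columns to the
strands; the entries are `1 - T` for the overstrand, `-1` for the understrand on the left and `T` for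
the understrand on the right. (If a strand plays several of these roles at a crossing, the
coefficients are added.) -/
def alexanderMatrix : Matrix D.Crossing D.Strand ℤ[T;T⁻¹] := fun c x =>
  (if D.IsOverstrand x c then 1 - LaurentPolynomial.T 1 else 0)
    + (if D.IsLeftUnderstrand x c then -1 else 0)
    + (if D.IsRightUnderstrand x c then LaurentPolynomial.T 1 else 0)

/-- `Δ` is the Alexander polynomial: the generator of the first elementary ideal of the Alexander
matrix that is a polynomial with positive constant term. -/
def IsAlexanderPolynomial (Δ : ℤ[X]) : Prop :=
  0 < Δ.coeff 0 ∧
    Ideal.span {Polynomial.toLaurent Δ} = elementaryIdeal 1 D.alexanderMatrix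

/-- The matrix `M(t)` over a ring `R`, for a unit `t` of `R`. -/
def foxMatrix {R : Type*} [CommRing R] (t : Rˣ) : Matrix D.Crossing D.Strand R :=
  D.alexanderMatrix.map (LaurentPolynomial.eval₂ (Int.castRingHom R) t)

/-- The knot code: the colorings of the strands by elements of `F` that are annihilated by
`M(t)`. -/
def knotCode {F : Type*} [Field F] (t : Fˣ) : Submodule F (D.Strand → F) :=
  LinearMap.ker (D.foxMatrix t).mulVecLin

end KnotDiagram

/-! ### Parameters of codes -/

/-- The minimum Hamming distance of a linear code; it is `∞` for the zero code. -/
def minDist {F ι : Type*} [Field F] [DecidableEq F] [Fintype ι] (C : Submodule F (ι → F)) : ℕ∞ :=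
  ⨅ x ∈ C, ⨅ _ : x ≠ 0, (hammingNorm x : ℕ∞)

/-- `C` is an `[n, k, d]` code over `F`. -/
def IsCode {F ι : Type*} [Field F] [DecidableEq F] [Fintype ι] (C : Submodule F (ι → F))
    (n k d : ℕ) : Prop :=
  Fintype.card ι = n ∧ Module.finrank F C = k ∧ minDist C = d

/-- The code attains the Singleton bound `k ≤ n - d + 1` (maximum distance separable). -/
def IsMDS {F ι : Type*} [Field F] [DecidableEq F] [Fintype ι] (C : Submodule F (ι → F)) : Prop :=
  (Module.finrank F C : ℕ∞) + minDist C = Fintype.card ι + 1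

end

/-! ### Maximal minors of matrices whose rows and columns sum to zero. -/

section Minors

variable {V : Type*} [Fintype V]

/-! In an alternating diagram every strand is the overstrand of exactly one crossing. Indexing the
rows of `M(-1)` by overstrands turns it into `2 - α - β` for two permutations of the strands: the
Laplacian of a digraph with two arrows into and two out of every vertex. Reducedness excludes loops.

The theorem reduces to `IsArrowColoring.injective`: every nonconstant coloring mod `p` takes
distinct values. The code parameters follow by `isCode_of_injective`.

All first minors are `± p`, so the rows span over the integers every vector of sum zero killed mod
`p` by a nonconstant coloring `x` (`exists_vecMul_eq_of_sum_eq_zero`). If `x i = x k`, then `e_i -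
e_k` is the row combination with some integer coefficients `g`, and a superlevel set of `g`
separates `i` from `k` while being left by at most one arrow (`exists_cut_of_eq`). Such a cut splits
the digraph like a connected sum. Minimal cuts `T`, `T'` inside the two sides have at least two
vertices each, and by submodularity no nonconstant coloring repeats a color inside `T` or inside
`T'`. But `x` cut off outside `T` is a nonconstant coloring that is constant on `T'`: a
contradiction. -/

theorem exists_option_equiv {m : ℕ} (hm : Fintype.card V = m + 1) (f : Fin m ↪ V) :
    ∃ e : Option (Fin m) ≃ V, ∀ i, e (some i) = f i := by
  classical
  have hlt : (Finset.univ.map f).card < Fintype.card V := by simp [hm]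
  obtain ⟨a, ha⟩ : ∃ a, a ∉ Finset.univ.map f := by
    by_contra! h
    exact hlt.ne (by rw [Finset.eq_univ_iff_forall.2 h, Finset.card_univ])
  let F : Option (Fin m) → V := fun o => o.elim a f
  have hF : Function.Injective F := by
    rintro (_ | i) (_ | j) h
    · rfl
    · exact absurd (Finset.mem_map.2 ⟨j, Finset.mem_univ _, h.symm⟩) ha
    · exact absurd (Finset.mem_map.2 ⟨i, Finset.mem_univ _, h⟩) ha
    · exact congrArg some (f.injective h)
  exact ⟨Equiv.ofBijective F ((Fintype.bijective_iff_injective_and_card F).2 ⟨hF, by simp [hm]⟩),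
    fun i => rfl⟩

theorem sum_eq_add_sum_option {m : ℕ} {R : Type*} [AddCommMonoid R] (e : Option (Fin m) ≃ V)
    (F : V → R) : ∑ v, F v = F (e none) + ∑ i, F (e (some i)) := by
  rw [← e.sum_comp, Fintype.sum_option]

/-- In a matrix with vanishing column sums all rows are combinations of any `m` of the `m + 1`
rows. -/
theorem exists_vecMul_submatrix {κ R : Type*} [CommRing R] {m : ℕ}
    (hm : Fintype.card V = m + 1) (A : Matrix V κ R) (hcol : ∀ x, ∑ c, A c x = 0)
    (f : Fin m ↪ V) (h : V → R) :
    ∃ h' : Fin m → R, ∀ x, ∑ c, h c * A c x = ∑ i, h' i * A (f i) x := by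
  obtain ⟨e, he⟩ := exists_option_equiv hm f
  refine ⟨fun i => h (f i) - h (e none), fun x => ?_⟩
  have h1 := hcol x
  rw [sum_eq_add_sum_option e] at h1 ⊢
  simp only [he] at h1 ⊢
  simp only [sub_mul, Finset.sum_sub_distrib, ← Finset.mul_sum]
  linear_combination (h (e none)) * h1

theorem det_submatrix_dvd_of_col_sum {κ R : Type*} [CommRing R] {m : ℕ}
    (hm : Fintype.card V = m + 1) (A : Matrix V κ R) (hcol : ∀ x, ∑ c, A c x = 0)
    (f f' : Fin m ↪ V) (g : Fin m → κ) :
    (A.submatrix f g).det ∣ (A.submatrix f' g).det := by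
  classical
  choose U hU using fun i => exists_vecMul_submatrix hm A hcol f (Pi.single (f' i) 1)
  have : A.submatrix f' g = Matrix.of U * A.submatrix f g := by
    ext i j
    have := hU i (g j)
    rw [Matrix.mul_apply]
    simpa [Pi.single_apply] using this
  rw [this, Matrix.det_mul]
  exact dvd_mul_left _ _

/-- Rows are exchanged first, then columns by passing to the transpose. -/
theorem det_submatrix_dvd {R : Type*} [CommRing R] {m : ℕ}
    (hm : Fintype.card V = m + 1) (A : Matrix V V R) (hcol : ∀ x, ∑ c, A c x = 0)
    (hrow : ∀ c, ∑ x, A c x = 0) (f f' g g' : Fin m ↪ V) :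
    (A.submatrix f g).det ∣ (A.submatrix f' g').det := by
  refine (det_submatrix_dvd_of_col_sum hm A hcol f f' g).trans ?_
  have := det_submatrix_dvd_of_col_sum hm A.transpose hrow g g' f'
  rwa [← Matrix.transpose_submatrix, ← Matrix.transpose_submatrix, Matrix.det_transpose,
    Matrix.det_transpose] at this

/-- The minors divide each other, so each of them alone generates the ideal. -/
theorem natAbs_det_submatrix_eq {m : ℕ} {p : ℕ}
    (hm : Fintype.card V = m + 1) (A : Matrix V V ℤ) (hcol : ∀ x, ∑ c, A c x = 0)
    (hrow : ∀ c, ∑ x, A c x = 0)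
    (hp : Ideal.span {d | ∃ f g : Fin m ↪ V, d = (A.submatrix f g).det} = Ideal.span {(p : ℤ)})
    (f g : Fin m ↪ V) : (A.submatrix f g).det.natAbs = p := by
  have h1 : (p : ℤ) ∣ (A.submatrix f g).det := by
    rw [← Ideal.mem_span_singleton, ← hp]
    exact Ideal.subset_span ⟨f, g, rfl⟩
  have h2 : (A.submatrix f g).det ∣ (p : ℤ) := by
    have : Ideal.span {(p : ℤ)} ≤ Ideal.span {(A.submatrix f g).det} := by
      rw [← hp, Ideal.span_le]
      rintro d ⟨f', g', rfl⟩
      exact Ideal.mem_span_singleton.2 (det_submatrix_dvd hm A hcol hrow _ _ _ _)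
    exact Ideal.mem_span_singleton.1 (this (Ideal.mem_span_singleton_self _))
  exact Nat.dvd_antisymm (by simpa using Int.natAbs_dvd_natAbs.2 h2)
    (by simpa using Int.natAbs_dvd_natAbs.2 h1)

end Minors

/-! ### The integer row lattice and colorings mod `p`. -/

section RowLattice

theorem index_range_vecMulLinear {ι : Type*} [Fintype ι] [DecidableEq ι] (N : Matrix ι ι ℤ)
    (hN : N.det ≠ 0) :
    (N.vecMulLinear.range.toAddSubgroup).index = N.det.natAbs := by
  have hinj : Function.Injective N.vecMulLinear := by
    intro a b h
    by_contra hab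
    refine hN (Matrix.exists_vecMul_eq_zero_iff.1 ⟨a - b, sub_ne_zero.2 hab, ?_⟩)
    rw [Matrix.sub_vecMul]
    exact sub_eq_zero.2 h
  let e := LinearEquiv.ofInjective N.vecMulLinear hinj
  have h := Submodule.natAbs_det_equiv N.vecMulLinear.range e
  have h2 : (N.vecMulLinear.range.subtype ∘ₗ AddMonoidHom.toIntLinearMap
      (e : (ι → ℤ) →+ N.vecMulLinear.range)) = N.transpose.mulVecLin := by
    ext a i
    simp [e]
  rw [h2, ← Matrix.toLin'_apply', LinearMap.det_toLin', Matrix.det_transpose] at h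
  rw [h]
  rfl

/-- If the determinant of `N` is `± p`, then the rows of `N` span the kernel of every non-zero
functional mod `p` that annihilates them. -/
theorem mem_range_vecMul_of_prime {ι : Type*} [Fintype ι] [DecidableEq ι] {p : ℕ} [Fact p.Prime]
    (N : Matrix ι ι ℤ) (hN : N.det.natAbs = p) (x : ι → ZMod p) (hx : x ≠ 0)
    (hNx : ∀ i, ∑ j, (N i j : ZMod p) * x j = 0) (w : ι → ℤ)
    (hw : ∑ j, (w j : ZMod p) * x j = 0) : ∃ h : ι → ℤ, Matrix.vecMul h N = w := by
  have hp : p.Prime := Fact.out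
  let φ : (ι → ℤ) →+ ZMod p :=
    { toFun := fun w => ∑ j, (w j : ZMod p) * x j
      map_zero' := by simp
      map_add' := fun a b => by simp [add_mul, Finset.sum_add_distrib] }
  have hφ : φ.ker.index = p := by
    rw [AddSubgroup.index_ker]
    have hsurj : Function.Surjective φ := by
      obtain ⟨j, hj⟩ := Function.ne_iff.1 hx
      intro z
      obtain ⟨k, hk⟩ := ZMod.intCast_surjective (z * (x j)⁻¹)
      refine ⟨Pi.single j k, ?_⟩
      change ∑ i, ((Pi.single j k : ι → ℤ) i : ZMod p) * x i = z
      rw [Finset.sum_eq_single j]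
      · simp only [Pi.single_eq_same, hk]
        exact inv_mul_cancel_right₀ hj z
      · intro b _ hb
        simp [Pi.single_eq_of_ne hb]
      · simp
    rw [AddMonoidHom.range_eq_top.2 hsurj]
    simp
  have hidx := index_range_vecMulLinear N (fun h => hp.ne_zero (by rw [← hN, h]; rfl))
  rw [hN] at hidx
  -- The row lattice lies in the kernel of `φ`, and both have index `p`, so they coincide.
  have hle : N.vecMulLinear.range.toAddSubgroup ≤ φ.ker := by
    rintro _ ⟨h, rfl⟩
    change ∑ j, ((Matrix.vecMul h N j : ℤ) : ZMod p) * x j = 0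
    simp only [Matrix.vecMul, dotProduct, Int.cast_sum, Int.cast_mul, Finset.sum_mul, mul_assoc]
    rw [Finset.sum_comm]
    simp [← Finset.mul_sum, hNx]
  have heq : φ.ker ≤ N.vecMulLinear.range.toAddSubgroup := by
    rw [← AddSubgroup.relIndex_eq_one]
    have := AddSubgroup.relIndex_mul_index hle
    rw [hφ, hidx] at this
    exact Nat.eq_of_mul_eq_mul_right hp.pos (by simpa using this)
  obtain ⟨h, hh⟩ := heq (show w ∈ φ.ker from hw)
  exact ⟨h, hh⟩

variable {V : Type*} [Fintype V] {p : ℕ} [Fact p.Prime]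

/-- Deleting one row and the same column leaves a matrix of determinant `± p`. Subtracting from `x`
its value at the deleted vertex gives a functional on the remaining coordinates; it is nonzero
because `x` is not constant. -/
theorem exists_vecMul_eq_of_sum_eq_zero {m : ℕ}
    (hm : Fintype.card V = m + 1) (A : Matrix V V ℤ) (hcol : ∀ x, ∑ c, A c x = 0)
    (hrow : ∀ c, ∑ x, A c x = 0)
    (hp : Ideal.span {d | ∃ f g : Fin m ↪ V, d = (A.submatrix f g).det} = Ideal.span {(p : ℤ)})
    (x : V → ZMod p) (hx : ∃ a b, x a ≠ x b) (hAx : ∀ c, ∑ v, (A c v : ZMod p) * x v = 0)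
    (w : V → ℤ) (hw0 : ∑ v, w v = 0) (hw : ∑ v, (w v : ZMod p) * x v = 0) :
    ∃ h : V → ℤ, ∀ v, ∑ c, h c * A c v = w v := by
  classical
  obtain ⟨e⟩ : Nonempty (Option (Fin m) ≃ V) := by
    rw [← Fintype.card_eq]; simp [hm]
  let f : Fin m ↪ V := ⟨fun i => e (some i), fun i j h => by simpa using h⟩
  have hsum : ∀ u : V → ℤ, ∑ v, u v = 0 → ∑ v, (u v : ZMod p) * x v = 0 →
      ∑ i, (u (f i) : ZMod p) * (x (f i) - x (e none)) = 0 := by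
    intro u hu hux
    have hu' : ∑ v, (u v : ZMod p) = 0 := by exact_mod_cast congrArg (Int.cast : ℤ → ZMod p) hu
    rw [sum_eq_add_sum_option e] at hux hu'
    simp only [mul_sub, Finset.sum_sub_distrib, ← Finset.sum_mul]
    change ∑ i, (u (e (some i)) : ZMod p) * x (e (some i)) -
      (∑ i, (u (e (some i)) : ZMod p)) * x (e none) = 0
    linear_combination hux - x (e none) * hu'
  obtain ⟨h, hh⟩ := mem_range_vecMul_of_prime (A.submatrix f f)
    (natAbs_det_submatrix_eq hm A hcol hrow hp f f) (fun i => x (f i) - x (e none))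
    (by
      intro h0
      have hc : ∀ v, x v = x (e none) := by
        intro v
        obtain ⟨o, rfl⟩ := e.surjective v
        cases o with
        | none => rfl
        | some i => exact sub_eq_zero.1 (congrFun h0 i)
      obtain ⟨a, b, hab⟩ := hx
      exact hab ((hc a).trans (hc b).symm))
    (fun i => hsum _ (hrow (f i)) (hAx (f i))) (fun i => w (f i)) (hsum w hw0 hw)
  let H : V → ℤ := fun v => (e.symm v).elim 0 h
  have hH : ∀ v, ∑ c, H c * A c v = ∑ i, h i * A (f i) v := by
    intro v
    rw [sum_eq_add_sum_option e]
    simp only [H, Equiv.symm_apply_apply, Option.elim, zero_mul, zero_add]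
    rfl
  have hHf : ∀ i, ∑ c, H c * A c (f i) = w (f i) := fun i => (hH (f i)).trans (congrFun hh i)
  refine ⟨H, fun v => ?_⟩
  obtain ⟨o, rfl⟩ := e.surjective v
  cases o with
  | some i => exact hHf i
  | none =>
    -- The deleted coordinate is forced, since both sides have total sum zero.
    have h1 : ∑ v, ∑ c, H c * A c v = 0 := by
      rw [Finset.sum_comm]
      simp [← Finset.mul_sum, hrow]
    rw [sum_eq_add_sum_option e] at h1 hw0
    have h2 : ∑ i, ∑ c, H c * A c (e (some i)) = ∑ i, w (e (some i)) :=
      Finset.sum_congr rfl fun i _ => hHf i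
    linarith

/-- A first minor vanishes mod `p`. A kernel vector of that submatrix, extended by zero, satisfies
all rows but one, and the last row follows from the column sums. -/
theorem exists_nonconstant_of_span_minors {m : ℕ}
    (hm : Fintype.card V = m + 1) (A : Matrix V V ℤ) (hcol : ∀ x, ∑ c, A c x = 0)
    (hp : Ideal.span {d | ∃ f g : Fin m ↪ V, d = (A.submatrix f g).det} = Ideal.span {(p : ℤ)}) :
    ∃ x : V → ZMod p, (∃ a b, x a ≠ x b) ∧ ∀ c, ∑ v, (A c v : ZMod p) * x v = 0 := by
  classical
  obtain ⟨e⟩ : Nonempty (Option (Fin m) ≃ V) := by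
    rw [← Fintype.card_eq]; simp [hm]
  let f : Fin m ↪ V := ⟨fun i => e (some i), fun i j h => by simpa using h⟩
  have h1 : (p : ℤ) ∣ (A.submatrix f f).det := by
    rw [← Ideal.mem_span_singleton, ← hp]
    exact Ideal.subset_span ⟨f, f, rfl⟩
  have h2 : ((A.submatrix f f).map (Int.castRingHom (ZMod p))).det = 0 := by
    rw [← RingHom.mapMatrix_apply, ← RingHom.map_det]
    exact (ZMod.intCast_zmod_eq_zero_iff_dvd _ _).2 h1
  obtain ⟨y, hy0, hy⟩ := Matrix.exists_mulVec_eq_zero_iff.2 h2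
  let x : V → ZMod p := fun v => (e.symm v).elim 0 y
  have hx : ∀ c, ∑ v, (A c v : ZMod p) * x v = ∑ i, (A c (f i) : ZMod p) * y i := by
    intro c
    rw [sum_eq_add_sum_option e]
    simp only [x, Equiv.symm_apply_apply, Option.elim, mul_zero, zero_add]
    rfl
  have hxf : ∀ i, ∑ v, (A (f i) v : ZMod p) * x v = 0 := fun i =>
    (hx (f i)).trans (congrFun hy i)
  refine ⟨x, ?_, fun c => ?_⟩
  · obtain ⟨i, hi⟩ := Function.ne_iff.1 hy0
    exact ⟨e (some i), e none, by simpa [x] using hi⟩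
  · obtain ⟨o, rfl⟩ := e.surjective c
    cases o with
    | some i => exact hxf i
    | none =>
      have h3 : ∑ c, ∑ v, (A c v : ZMod p) * x v = 0 := by
        rw [Finset.sum_comm]
        refine Finset.sum_eq_zero fun v _ => ?_
        rw [← Finset.sum_mul, ← Int.cast_sum, hcol]
        simp
      rwa [sum_eq_add_sum_option e, show ∑ i, ∑ v, (A (e (some i)) v : ZMod p) * x v = 0 from
        Finset.sum_eq_zero fun i _ => hxf i, add_zero] at h3

end RowLattice

/-! ### Small cuts in the digraph of two permutations. -/

section Cuts

/-- The number of arrows that leave `S` in the digraph with arrows `v → α v` and `v → β v`. -/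
def cutSize {V : Type*} [DecidableEq V] (α β : Equiv.Perm V) (S : Finset V) : ℕ :=
  (S.filter fun v => α v ∉ S).card + (S.filter fun v => β v ∉ S).card

theorem cutSize_singleton {V : Type*} [DecidableEq V] (α β : Equiv.Perm V)
    (hα : ∀ v, α v ≠ v) (hβ : ∀ v, β v ≠ v) (v : V) : cutSize α β {v} = 2 := by
  simp [cutSize, Finset.filter_singleton, hα, hβ]

/-- Without loops a single vertex is left by two arrows, so a minimal set has at least two elements.
-/
theorem exists_minimal_cut {V : Type*} [DecidableEq V] {α β : Equiv.Perm V}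
    (hα : ∀ v, α v ≠ v) (hβ : ∀ v, β v ≠ v) {S : Finset V} (hS :
    cutSize α β S ≤ 1) (hne : S.Nonempty) :
    ∃ T ⊆ S, cutSize α β T ≤ 1 ∧ (∃ i ∈ T, ∃ k ∈ T, i ≠ k) ∧
      ∀ T' ⊂ T, T'.Nonempty → ¬ cutSize α β T' ≤ 1 := by
  obtain ⟨T, hTS, hT⟩ := exists_minimal_le_of_wellFoundedLT
    (fun T : Finset V => T.Nonempty ∧ cutSize α β T ≤ 1) S ⟨hne, hS⟩
  refine ⟨T, hTS, hT.prop.2, ?_, fun T' hT' h1 h2 => ?_⟩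
  · obtain ⟨i, hi⟩ := hT.prop.1
    by_contra! h
    have : T = {i} := Finset.eq_singleton_iff_unique_mem.2 ⟨hi, fun k hk => (h i hi k hk).symm⟩
    have h2 := hT.prop.2
    rw [this, cutSize_singleton α β hα hβ] at h2
    omega
  · exact hT'.2 (hT.le_of_le ⟨h1, h2⟩ hT'.1)

/-- A function satisfying the coloring equations. -/
def IsArrowColoring {V R : Type*} [CommRing R] (α β : Equiv.Perm V) (x : V → R) : Prop :=
  ∀ v, 2 * x v = x (α v) + x (β v)

theorem IsArrowColoring.symm {V R : Type*} [CommRing R] {α β : Equiv.Perm V} {x : V → R}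
    (hx : IsArrowColoring α β x) : IsArrowColoring β α x :=
  fun v => (hx v).trans (add_comm _ _)

variable {V : Type*} [Fintype V] [DecidableEq V]

variable (α β : Equiv.Perm V)

theorem card_entering_eq_card_leaving (S : Finset V) :
    (Sᶜ.filter fun v => α v ∈ S).card = (S.filter fun v => α v ∉ S).card := by
  have h1 : (Finset.univ.filter fun v => α v ∈ S).card = S.card := by
    rw [← Finset.card_map α.toEmbedding]
    congr 1
    ext v
    rw [Finset.mem_map_equiv]
    simp
  have h2 := Finset.card_filter_add_card_filter_not (s := S) (fun v => α v ∈ S)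
  have h3 : (Finset.univ.filter fun v => α v ∈ S) =
      (S.filter fun v => α v ∈ S) ∪ (Sᶜ.filter fun v => α v ∈ S) := by
    rw [← Finset.filter_union, Finset.union_compl]
  rw [h3, Finset.card_union_of_disjoint] at h1
  · omega
  · exact Finset.disjoint_filter_filter disjoint_compl_right

theorem cutSize_compl (S : Finset V) : cutSize α β Sᶜ = cutSize α β S := by
  simp only [cutSize, Finset.mem_compl, not_not, card_entering_eq_card_leaving]

theorem cutSize_eq_sum (S : Finset V) : cutSize α β S =
    ∑ v, ((if v ∈ S ∧ α v ∉ S then 1 else 0) + (if v ∈ S ∧ β v ∉ S then 1 else 0)) := by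
  have h : ∀ P : V → Prop, [DecidablePred P] →
      S.filter P = Finset.univ.filter fun v => v ∈ S ∧ P v := by
    intro P _; ext; simp
  rw [cutSize, h, h, Finset.card_filter, Finset.card_filter, Finset.sum_add_distrib]

/-- Submodularity, checked arrow by arrow. -/
theorem cutSize_inter_add_cutSize_union (S T : Finset V) :
    cutSize α β (S ∩ T) + cutSize α β (S ∪ T) ≤ cutSize α β S + cutSize α β T := by
  simp only [cutSize_eq_sum, ← Finset.sum_add_distrib]
  have key : ∀ γ : Equiv.Perm V, ∀ v,
      (if v ∈ S ∩ T ∧ γ v ∉ S ∩ T then 1 else 0) + (if v ∈ S ∪ T ∧ γ v ∉ S ∪ T then 1 else 0) ≤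
      (if v ∈ S ∧ γ v ∉ S then 1 else 0) + (if v ∈ T ∧ γ v ∉ T then 1 else 0) := by
    intro γ v
    by_cases h1 : v ∈ S <;> by_cases h2 : v ∈ T <;> by_cases h3 : γ v ∈ S <;>
      by_cases h4 : γ v ∈ T <;> simp [h1, h2, h3, h4]
  refine Finset.sum_le_sum fun v _ => ?_
  have h1 := key α v
  have h2 := key β v
  omega

theorem mem_iff_of_cutSize_eq_zero {S : Finset V} (h : cutSize α β S = 0) (v : V) :
    (α v ∈ S ↔ v ∈ S) ∧ (β v ∈ S ↔ v ∈ S) := by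
  have key : ∀ γ : Equiv.Perm V, (S.filter fun v => γ v ∉ S).card = 0 → (γ v ∈ S ↔ v ∈ S) := by
    intro γ hγ
    have hγ' := card_entering_eq_card_leaving γ S
    rw [hγ] at hγ'
    rw [Finset.card_eq_zero, Finset.filter_eq_empty_iff] at hγ hγ'
    exact ⟨fun h => by_contra fun hv => hγ' (Finset.mem_compl.2 hv) h,
      fun h => not_not.1 (hγ h)⟩
  exact ⟨key α (Nat.eq_zero_of_add_eq_zero_right h), key β (Nat.eq_zero_of_add_eq_zero_left h)⟩

/-- The matrix `2 - α - β`. -/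
def arrowMatrix : Matrix V V ℤ := fun v x =>
  2 * (if x = v then 1 else 0) - (if x = α v then 1 else 0) - (if x = β v then 1 else 0)

theorem arrowMatrix_row_sum (v : V) : ∑ x, arrowMatrix α β v x = 0 := by
  simp [arrowMatrix, Finset.sum_sub_distrib]

theorem sum_mul_arrowMatrix (g : V → ℤ) (x : V) :
    ∑ v, g v * arrowMatrix α β v x = 2 * g x - g (α.symm x) - g (β.symm x) := by
  have h : ∀ γ : Equiv.Perm V, ∀ v, (x = γ v) = (v = γ.symm x) := fun γ v => by
    rw [eq_iff_iff, Equiv.eq_symm_apply, eq_comm]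
  simp only [arrowMatrix, mul_sub, Finset.sum_sub_distrib, h]
  simp [mul_comm]

theorem arrowMatrix_col_sum (x : V) : ∑ v, arrowMatrix α β v x = 0 := by
  have := sum_mul_arrowMatrix α β 1 x
  simpa using this

theorem arrowMatrix_mulVec {R : Type*} [CommRing R] (y : V → R) (v : V) :
    ∑ x, (arrowMatrix α β v x : R) * y x = 2 * y v - y (α v) - y (β v) := by
  simp [arrowMatrix, sub_mul, Finset.sum_sub_distrib]

/-- The coefficients `g` may be shifted by any constant `k` because the columns sum to zero. -/
theorem sum_netFlow (g : V → ℤ) (S : Finset V) (w : V → ℤ)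
    (hg : ∀ x, ∑ v, g v * arrowMatrix α β v x = w x) (k : ℤ) :
    ∑ x ∈ S, w x = ∑ v, ((g v - k) * ((if v ∈ S then 1 else 0) - (if α v ∈ S then 1 else 0)) +
      (g v - k) * ((if v ∈ S then 1 else 0) - (if β v ∈ S then 1 else 0))) := by
  have hg' : ∀ x, ∑ v, (g v - k) * arrowMatrix α β v x = w x := by
    intro x
    simp only [sub_mul, Finset.sum_sub_distrib, hg, ← Finset.mul_sum, arrowMatrix_col_sum]
    simp
  simp only [← hg']
  rw [Finset.sum_comm]
  refine Finset.sum_congr rfl fun v _ => ?_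
  rw [← Finset.mul_sum]
  simp only [arrowMatrix, Finset.sum_sub_distrib, ← Finset.mul_sum, Finset.sum_ite_eq']
  ring

/-- After the shift by `t - 1`, an arrow leaving the superlevel set starts where the shifted `g` is
at least 1, and an entering one where it is at most 0, so the former contributes at least 1 and the
latter nothing negative. -/
theorem cutSize_le_sum (g : V → ℤ) (w : V → ℤ)
    (hg : ∀ x, ∑ v, g v * arrowMatrix α β v x = w x) (t : ℤ) :
    (cutSize α β (Finset.univ.filter fun v => t ≤ g v) : ℤ) ≤
      ∑ x ∈ Finset.univ.filter (fun v => t ≤ g v), w x := by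
  rw [sum_netFlow α β g _ w hg (t - 1), cutSize_eq_sum]
  push_cast
  refine Finset.sum_le_sum fun v _ => ?_
  have key : ∀ γ : Equiv.Perm V,
      (if v ∈ Finset.univ.filter (fun v => t ≤ g v) ∧
        γ v ∉ Finset.univ.filter (fun v => t ≤ g v) then (1 : ℤ) else 0) ≤
      (g v - (t - 1)) * ((if v ∈ Finset.univ.filter (fun v => t ≤ g v) then 1 else 0) -
        (if γ v ∈ Finset.univ.filter (fun v => t ≤ g v) then 1 else 0)) := by
    intro γ
    simp only [Finset.mem_filter, Finset.mem_univ, true_and]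
    split_ifs <;> omega
  exact add_le_add (key α) (key β)

theorem sum_eq_zero_of_cutSize_eq_zero (g : V → ℤ) (w : V → ℤ)
    (hg : ∀ x, ∑ v, g v * arrowMatrix α β v x = w x) {S : Finset V} (hS : cutSize α β S = 0) :
    ∑ x ∈ S, w x = 0 := by
  rw [sum_netFlow α β g S w hg 0]
  refine Finset.sum_eq_zero fun v _ => ?_
  obtain ⟨h1, h2⟩ := mem_iff_of_cutSize_eq_zero α β hS v
  simp [h1, h2]

variable {α β}

/-- The equations add up to a trivial identity, so one of them is redundant. -/
theorem IsArrowColoring.of_forall_ne {R : Type*} [CommRing R] {y : V → R} {a : V}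
    (h : ∀ v, v ≠ a → 2 * y v = y (α v) + y (β v)) : IsArrowColoring α β y := by
  intro v
  by_cases hv : v = a
  · subst hv
    have h1 : ∑ u, (2 * y u - y (α u) - y (β u)) = 0 := by
      rw [Finset.sum_sub_distrib, Finset.sum_sub_distrib, Equiv.sum_comp α, Equiv.sum_comp β,
        ← Finset.mul_sum]
      ring
    rw [Finset.sum_eq_single v (fun u _ hu => by rw [h u hu]; ring) (by simp)] at h1
    linear_combination h1
  · exact h v hv

/-- If an arrow leaves `T`, say from `a`, then `c` is the color at its head, which makes the
equation at `a` survive the cutoff. Exactly one arrow enters `T`; the equation at its tail `b` is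
the redundant one. -/
theorem IsArrowColoring.exists_restrict_aux {R : Type*} [CommRing R] {x : V → R}
    (hx : IsArrowColoring α β x) {T : Finset V}
    (h1 : (T.filter fun v => α v ∉ T).card ≤ 1) (h2 : (T.filter fun v => β v ∉ T).card = 0) :
    ∃ c : R, IsArrowColoring α β fun v => if v ∈ T then x v - c else 0 := by
  have hβ : ∀ v, β v ∈ T ↔ v ∈ T := fun v =>
    (mem_iff_of_cutSize_eq_zero β β (by rw [cutSize, h2]) v).1
  rcases Nat.le_one_iff_eq_zero_or_eq_one.1 h1 with h1 | h1
  · have hα : ∀ v, α v ∈ T ↔ v ∈ T := fun v =>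
      (mem_iff_of_cutSize_eq_zero α α (by rw [cutSize, h1]) v).1
    refine ⟨0, fun v => ?_⟩
    by_cases hv : v ∈ T <;> simp [hα, hβ, hv, hx v]
  · have h3 := (card_entering_eq_card_leaving α T).trans h1
    obtain ⟨a, ha⟩ := Finset.card_eq_one.1 h1
    obtain ⟨b, hb⟩ := Finset.card_eq_one.1 h3
    have ha' : ∀ v, v ∈ T → (α v ∉ T ↔ v = a) := fun v hv => by
      have := Finset.ext_iff.1 ha v
      simpa [hv] using this
    have hb' : ∀ v, v ∉ T → v ≠ b → α v ∉ T := fun v hv hvb h => by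
      have := Finset.ext_iff.1 hb v
      simp [hv, h, hvb] at this
    refine ⟨x (α a), IsArrowColoring.of_forall_ne (a := b) fun v hvb => ?_⟩
    by_cases hv : v ∈ T
    · by_cases hva : v = a
      · have : α v ∉ T := (ha' v hv).2 hva
        simp only [hv, hβ, this, if_true, if_false]
        rw [← hva]
        linear_combination hx v
      · have : α v ∈ T := not_not.1 fun h => hva ((ha' v hv).1 h)
        simp only [hv, hβ, this, if_true]
        linear_combination hx v
    · simp [hv, hβ, hb' v hv hvb]

/-- A coloring can be cut off at a set that is left by at most one arrow. -/
theorem IsArrowColoring.exists_restrict {R : Type*} [CommRing R] {x : V → R}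
    (hx : IsArrowColoring α β x) {T : Finset V} (hT : cutSize α β T ≤ 1) :
    ∃ c : R, IsArrowColoring α β fun v => if v ∈ T then x v - c else 0 := by
  unfold cutSize at hT
  by_cases h : (T.filter fun v => β v ∉ T).card = 0
  · exact hx.exists_restrict_aux (by omega) h
  · obtain ⟨c, hc⟩ := hx.symm.exists_restrict_aux (T := T) (by omega) (by omega)
    exact ⟨c, hc.symm⟩

/-- A set left by at most one arrow that is cut by another such set contains a smaller one. -/
theorem exists_ssubset_cutSize_le_one {S T : Finset V} (hT : cutSize α β T ≤ 1)
    (hTu : T ≠ Finset.univ) (hS : cutSize α β S ≤ 1) {i k : V} (hi : i ∈ T) (hk : k ∈ T)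
    (hiS : i ∈ S) (hkS : k ∉ S)
    (hconn : ∀ U : Finset V, U.Nonempty → U ≠ Finset.univ → 1 ≤ cutSize α β U) :
    ∃ T' ⊂ T, T'.Nonempty ∧ cutSize α β T' ≤ 1 := by
  obtain ⟨z, hz⟩ : ∃ z, z ∉ T := by
    by_contra! h
    exact hTu (Finset.eq_univ_iff_forall.2 h)
  have main : ∀ S : Finset V, ∀ i k, cutSize α β S ≤ 1 → i ∈ T → k ∈ T → i ∈ S → k ∉ S → z ∉ S →
      ∃ T' ⊂ T, T'.Nonempty ∧ cutSize α β T' ≤ 1 := by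
    intro S i k hS hi hk hiS hkS hzS
    refine ⟨T ∩ S, ?_, ⟨i, by simp [hi, hiS]⟩, ?_⟩
    · refine Finset.ssubset_iff_subset_ne.2 ⟨Finset.inter_subset_left, fun h => hkS ?_⟩
      exact Finset.inter_eq_left.1 h hk
    · have h1 := cutSize_inter_add_cutSize_union α β T S
      have h2 := hconn (T ∪ S) ⟨i, by simp [hi]⟩ (fun h => by
        have := Finset.eq_univ_iff_forall.1 h z
        simp [hz, hzS] at this)
      omega
  -- Passing to the complement if necessary, `z` lies outside `T ∪ S`; this union is then left by an
  -- arrow, and submodularity bounds the cut of the intersection.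
  by_cases hzS : z ∈ S
  · exact main Sᶜ k i (by rwa [cutSize_compl]) hk hi (by simpa) (by simpa) (by simpa)
  · exact main S i k hS hi hk hiS hkS hzS

variable {p : ℕ} [Fact p.Prime] {m : ℕ}

/-- Two places with the same color are separated by a set left by at most one arrow, and every
proper non-empty set is left by some arrow. -/
theorem exists_cut_of_eq (hm : Fintype.card V = m + 1)
    (hp : Ideal.span {d | ∃ f g : Fin m ↪ V, d = ((arrowMatrix α β).submatrix f g).det} =
      Ideal.span {(p : ℤ)})
    {x : V → ZMod p} (hx : IsArrowColoring α β x) (hxne : ∃ a b, x a ≠ x b) :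
    (∀ U : Finset V, U.Nonempty → U ≠ Finset.univ → 1 ≤ cutSize α β U) ∧
    ∀ i k, i ≠ k → x i = x k → ∃ S : Finset V, cutSize α β S ≤ 1 ∧ i ∈ S ∧ k ∉ S := by
  have key := exists_vecMul_eq_of_sum_eq_zero hm (arrowMatrix α β) (arrowMatrix_col_sum α β)
    (arrowMatrix_row_sum α β) hp x hxne (fun v => by
      rw [arrowMatrix_mulVec, hx v]; ring)
  have hconn : ∀ U : Finset V, U.Nonempty → U ≠ Finset.univ → 1 ≤ cutSize α β U := by
    rintro U ⟨a, ha⟩ hU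
    obtain ⟨b, hb⟩ : ∃ b, b ∉ U := by
      by_contra! h
      exact hU (Finset.eq_univ_iff_forall.2 h)
    by_contra! h0
    -- The factor `p` puts the vector into the row lattice whatever the colors of `a` and `b` are;
    -- its sum over `U` is `p`, not zero.
    obtain ⟨g, hg⟩ := key (fun v => p * ((if v = a then 1 else 0) - (if v = b then 1 else 0)))
      (by simp [← Finset.mul_sum]) (by simp)
    have h1 := sum_eq_zero_of_cutSize_eq_zero α β g _ hg (S := U) (by omega)
    simp [← Finset.mul_sum, ha, hb, (Fact.out : p.Prime).ne_zero] at h1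
  refine ⟨hconn, fun i k hik hxik => ?_⟩
  obtain ⟨g, hg⟩ := key (fun v => (if v = i then 1 else 0) - (if v = k then 1 else 0))
    (by simp) (by simp [sub_mul, hxik])
  have hle := cutSize_le_sum α β g _ hg
  simp only [Finset.sum_sub_distrib, Finset.sum_ite_eq', Finset.mem_filter, Finset.mem_univ,
    true_and] at hle
  rcases lt_trichotomy (g i) (g k) with h | h | h
  -- This case is vacuous: the level `g k` would bound a cut size by `-1`.
  · refine ⟨(Finset.univ.filter fun v => g k ≤ g v)ᶜ, ?_, by simpa using h, by simp⟩
    rw [cutSize_compl]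
    have := hle (g k)
    split_ifs at this <;> omega
  -- Also impossible: `g` is not constant, and a proper nonempty superlevel set contains both or
  -- neither of `i` and `k`, so no arrow would leave it.
  · obtain ⟨v, hv⟩ : ∃ v, g v ≠ g i := by
      by_contra! hc
      have := hg i
      simp [← Finset.mul_sum, hc, arrowMatrix_col_sum, hik] at this
    have h1 := hle (max (g v) (g i))
    have h2 := hconn (Finset.univ.filter fun u => max (g v) (g i) ≤ g u) (by
        rcases le_total (g v) (g i) with h' | h'
        · exact ⟨i, by simp [h']⟩
        · exact ⟨v, by simp [h']⟩) (fun hu => by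
        have h3 := Finset.eq_univ_iff_forall.1 hu v
        have h4 := Finset.eq_univ_iff_forall.1 hu i
        simp only [Finset.mem_filter, Finset.mem_univ, true_and] at h3 h4
        omega)
    rw [h] at h1
    simp only [sub_self] at h1
    rw [h] at h2
    omega
  · refine ⟨Finset.univ.filter fun v => g i ≤ g v, ?_, by simp, by simpa using h⟩
    have := hle (g i)
    split_ifs at this <;> omega

/-- A repeated color yields disjoint minimal cuts `T` and `T'`; primality of `p` prevents both from
carrying nonconstant colorings independently. -/
theorem IsArrowColoring.injective (hm : Fintype.card V = m + 1)
    (hp : Ideal.span {d | ∃ f g : Fin m ↪ V, d = ((arrowMatrix α β).submatrix f g).det} =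
      Ideal.span {(p : ℤ)}) (hα : ∀ v, α v ≠ v) (hβ : ∀ v, β v ≠ v)
    {x : V → ZMod p} (hx : IsArrowColoring α β x) (hxne : ∃ a b, x a ≠ x b) :
    Function.Injective x := by
  obtain ⟨hconn, hcut⟩ := exists_cut_of_eq hm hp hx hxne
  intro a b hab
  by_contra hne
  obtain ⟨S, hS, haS, hbS⟩ := hcut a b hne hab
  obtain ⟨T, hTS, hT, ⟨i, hi, k, hk, hik⟩, hTmin⟩ := exists_minimal_cut hα hβ hS ⟨a, haS⟩
  obtain ⟨T', hTS', hT', ⟨i', hi', k', hk', hik'⟩, hTmin'⟩ :=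
    exists_minimal_cut hα hβ (S := Sᶜ) (by rwa [cutSize_compl]) ⟨b, by simpa⟩
  have hdisj : ∀ v, v ∈ T' → v ∉ T := fun v h h' =>
    (Finset.mem_compl.1 (hTS' h)) (hTS h')
  have hTu : T ≠ Finset.univ := fun h => hdisj i' hi' (by simp [h])
  have hTu' : T' ≠ Finset.univ := fun h => hdisj i (by simp [h]) hi
  obtain ⟨c, hc⟩ := hx.exists_restrict hT
  have hxik : x i ≠ x k := by
    intro h
    obtain ⟨U, hU, hiU, hkU⟩ := hcut i k hik h
    obtain ⟨W, hW, hWne, hWc⟩ := exists_ssubset_cutSize_le_one hT hTu hU hi hk hiU hkU hconn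
    exact hTmin W hW hWne hWc
  -- The cut-off coloring is nonconstant on `T` and zero on `T'`, so it yields a cut that splits
  -- `T'`.
  obtain ⟨U, hU, hiU, hkU⟩ := (exists_cut_of_eq hm hp hc ⟨i, k, by simpa [hi, hk] using hxik⟩).2
    i' k' hik' (by simp [hdisj i' hi', hdisj k' hk'])
  obtain ⟨W, hW, hWne, hWc⟩ := exists_ssubset_cutSize_le_one hT' hTu' hU hi' hk' hiU hkU hconn
  exact hTmin' W hW hWne hWc

end Cuts

/-! ### Passages, strands and the permutations they define. -/

namespace KnotDiagram

variable (D : KnotDiagram)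

theorem overTime_mem (c : D.Crossing) : D.overTime c ∈ D.params :=
  (D.exists_over_under c).choose_spec.1

theorem underTime_mem (c : D.Crossing) : D.underTime c ∈ D.params :=
  (D.exists_over_under c).choose_spec.2.1

theorem shadow_overTime (c : D.Crossing) : D.shadow (D.overTime c) = c.1 :=
  (D.exists_over_under c).choose_spec.2.2.1

theorem shadow_underTime (c : D.Crossing) : D.shadow (D.underTime c) = c.1 :=
  (D.exists_over_under c).choose_spec.2.2.2.1

theorem height_underTime_lt (c : D.Crossing) :
    D.height (D.underTime c) < D.height (D.overTime c) :=
  (D.exists_over_under c).choose_spec.2.2.2.2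

theorem underTime_injective : Function.Injective D.underTime := fun c c' h =>
  Subtype.ext (by rw [← D.shadow_underTime c, h, D.shadow_underTime])

theorem underTime_ne_overTime (c c' : D.Crossing) : D.underTime c ≠ D.overTime c' := by
  intro h
  obtain rfl : c = c' := Subtype.ext (by rw [← D.shadow_underTime c, h, D.shadow_overTime])
  have := D.height_underTime_lt c
  rw [h] at this
  exact lt_irrefl _ this

theorem eq_overTime_or_eq_underTime (c : D.Crossing) {t : ℝ} (ht : t ∈ D.params)
    (h : D.shadow t = c.1) : t = D.overTime c ∨ t = D.underTime c := by
  obtain ⟨a, b, -, hab⟩ := Set.ncard_eq_two.1 (D.regular.double c.1 c.2)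
  have mem : ∀ s ∈ D.params, D.shadow s = c.1 → s = a ∨ s = b := fun s hs h => by
    have : s ∈ ({a, b} : Set ℝ) := hab ▸ ⟨hs, h⟩
    simpa using this
  have h1 := mem _ ht h
  have h2 := mem _ (D.overTime_mem c) (D.shadow_overTime c)
  have h3 := mem _ (D.underTime_mem c) (D.shadow_underTime c)
  have h4 := D.underTime_ne_overTime c c
  grind

theorem isPassage_overTime (c : D.Crossing) : D.IsPassage (D.overTime c) :=
  ⟨D.overTime_mem c, by rw [D.shadow_overTime]; exact c.2⟩

theorem isPassage_underTime (c : D.Crossing) : D.IsPassage (D.underTime c) :=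
  ⟨D.underTime_mem c, by rw [D.shadow_underTime]; exact c.2⟩

theorem isPassage_iff {t : ℝ} :
    D.IsPassage t ↔ ∃ c, t = D.overTime c ∨ t = D.underTime c := by
  constructor
  · rintro ⟨h1, h2⟩
    exact ⟨⟨_, h2⟩, D.eq_overTime_or_eq_underTime ⟨_, h2⟩ h1 rfl⟩
  · rintro ⟨c, rfl | rfl⟩
    exacts [D.isPassage_overTime c, D.isPassage_underTime c]

theorem not_isOver_underTime (c : D.Crossing) : ¬ D.IsOver (D.underTime c) := by
  rintro ⟨-, s, hs, h1, h2⟩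
  rw [D.shadow_underTime] at h1
  rcases D.eq_overTime_or_eq_underTime c hs h1 with rfl | rfl
  · exact lt_asymm h2 (D.height_underTime_lt c)
  · exact lt_irrefl _ h2

theorem not_isUnder_overTime (c : D.Crossing) : ¬ D.IsUnder (D.overTime c) := by
  rintro ⟨-, s, hs, h1, h2⟩
  rw [D.shadow_overTime] at h1
  rcases D.eq_overTime_or_eq_underTime c hs h1 with rfl | rfl
  · exact lt_irrefl _ h2
  · exact lt_asymm h2 (D.height_underTime_lt c)

theorem travel_right_injective {a b b' : ℝ} (hb : b ∈ D.params) (hb' : b' ∈ D.params)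
    (h : D.travel a b = D.travel a b') : b = b' := by
  obtain ⟨h1, h2⟩ := hb
  obtain ⟨h3, h4⟩ := hb'
  simp only [PolygonalKnot.travel] at h
  split_ifs at h <;> linarith

theorem travel_add {a b c : ℝ} (ha : a ∈ D.params) (hb : b ∈ D.params) (hc : c ∈ D.params)
    (h : D.travel a b < D.travel a c) : D.travel a b + D.travel b c = D.travel a c := by
  obtain ⟨h1, h2⟩ := ha
  obtain ⟨h3, h4⟩ := hb
  obtain ⟨h5, h6⟩ := hc
  simp only [PolygonalKnot.travel] at h ⊢
  split_ifs at h ⊢ <;> linarith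

theorem travel_add_of_lt {a b c d : ℝ} (ha : a ∈ D.params) (hb : b ∈ D.params)
    (hc : c ∈ D.params) (hd : d ∈ D.params) (h : D.travel a b < D.travel a c)
    (h' : D.travel b d < D.travel b c) : D.travel a b + D.travel b d = D.travel a d := by
  obtain ⟨h1, h2⟩ := ha
  obtain ⟨h3, h4⟩ := hb
  obtain ⟨h5, h6⟩ := hc
  obtain ⟨h7, h8⟩ := hd
  simp only [PolygonalKnot.travel] at h h' ⊢
  split_ifs at h h' ⊢ <;> linarith

theorem travel_le_self {a b : ℝ} (ha : a ∈ D.params) (hb : b ∈ D.params) :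
    D.travel a b ≤ D.travel a a := by
  obtain ⟨h1, h2⟩ := ha
  obtain ⟨h3, h4⟩ := hb
  simp only [PolygonalKnot.travel]
  split_ifs <;> linarith

theorem IsIncoming.right_unique {D : KnotDiagram} {x c c' : D.Crossing} (h : D.IsIncoming x c)
    (h' : D.IsIncoming x c') : c = c' :=
  D.underTime_injective (D.travel_right_injective (D.underTime_mem c) (D.underTime_mem c')
    (le_antisymm (h c') (h' c)))

theorem IsIncoming.left_unique {D : KnotDiagram} {x y c : D.Crossing} (h : D.IsIncoming x c)
    (h' : D.IsIncoming y c) : x = y := by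
  apply D.underTime_injective
  by_contra hne
  have h1 := h y
  have h2 := h' x
  obtain ⟨h3, h4⟩ := D.underTime_mem x
  obtain ⟨h5, h6⟩ := D.underTime_mem y
  obtain ⟨h7, h8⟩ := D.underTime_mem c
  rcases lt_or_gt_of_ne hne with hne | hne <;> simp only [PolygonalKnot.travel] at h1 h2 <;>
    split_ifs at h1 h2 <;> linarith

theorem exists_incoming_equiv :
    ∃ q : Equiv.Perm D.Crossing, ∀ x c, D.IsIncoming x c ↔ x = q c := by
  have hex : ∀ x, ∃ c, D.IsIncoming x c := fun x => by
    obtain ⟨c, -, hc⟩ := Finset.exists_min_image Finset.univ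
      (fun c => D.travel (D.underTime x) (D.underTime c)) ⟨x, Finset.mem_univ x⟩
    exact ⟨c, fun c' => hc c' (Finset.mem_univ _)⟩
  choose next hnext using hex
  have hinj : Function.Injective next := fun x y h =>
    (hnext x).left_unique (h ▸ hnext y)
  let e := Equiv.ofBijective next (Finite.injective_iff_bijective.1 hinj)
  refine ⟨e.symm, fun x c => ?_⟩
  rw [Equiv.eq_symm_apply]
  exact ⟨fun h => (hnext x).right_unique h, fun h => h ▸ hnext x⟩

theorem exists_next_passage (x : D.Crossing) :
    ∃ t, D.IsPassage t ∧ ∀ r, D.IsPassage r →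
      D.travel (D.underTime x) t ≤ D.travel (D.underTime x) r := by
  obtain ⟨c, -, hc⟩ := Finset.exists_min_image Finset.univ
    (fun c : D.Crossing ⊕ D.Crossing =>
      D.travel (D.underTime x) (c.elim D.overTime D.underTime)) ⟨Sum.inl x, Finset.mem_univ _⟩
  refine ⟨c.elim D.overTime D.underTime, ?_, fun r hr => ?_⟩
  · rcases c with c | c
    exacts [D.isPassage_overTime c, D.isPassage_underTime c]
  · obtain ⟨c', rfl | rfl⟩ := D.isPassage_iff.1 hr
    exacts [hc (Sum.inl c') (Finset.mem_univ _), hc (Sum.inr c') (Finset.mem_univ _)]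

variable {D}

/-- The first passage after the start of `x` is over, hence still on `x`. -/
theorem IsAlternating.exists_isOverstrand (halt : D.IsAlternating) (x : D.Crossing) :
    ∃ c, D.IsOverstrand x c := by
  obtain ⟨t, ht, hmin⟩ := D.exists_next_passage x
  rcases halt _ t (D.isPassage_underTime x) ht hmin with h | h
  · exact absurd h.1 (D.not_isOver_underTime x)
  · obtain ⟨c, rfl | rfl⟩ := D.isPassage_iff.1 ht
    · refine ⟨c, D.overTime_mem c, fun c' => lt_of_le_of_ne (hmin _ (D.isPassage_underTime c')) ?_⟩
      intro h'
      exact D.underTime_ne_overTime c' c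
        (D.travel_right_injective (D.overTime_mem c) (D.underTime_mem c') h').symm
    · exact absurd h.2 (D.not_isOver_underTime c)

/-- The map from crossings to overstrands is surjective between sets of equal finite size. -/
theorem IsAlternating.exists_overstrand_equiv (halt : D.IsAlternating) :
    ∃ o : Equiv.Perm D.Crossing, ∀ x c, D.IsOverstrand x c ↔ x = o c := by
  choose f hf using fun c : D.Crossing =>
    haveI : Nonempty D.Crossing := ⟨c⟩
    D.existsUnique_strand (D.overTime_mem c) (D.not_isUnder_overTime c)
  have hsurj : Function.Surjective f := fun x => by
    obtain ⟨c, hc⟩ := halt.exists_isOverstrand x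
    exact ⟨c, ((hf c).2 x hc).symm⟩
  refine ⟨Equiv.ofBijective f (Finite.surjective_iff_bijective.1 hsurj), fun x c => ?_⟩
  exact ⟨fun h => (hf c).2 x h, fun h => h ▸ (hf c).1⟩

/-- A strand has only one overpassage, so the arc from the start of the strand at `c` to its
overpassage at `c` would meet no crossing on its way, and `c` would be a kink. -/
theorem IsReduced.not_isOverstrand_self (hred : D.IsReduced) {o : Equiv.Perm D.Crossing}
    (ho : ∀ x c, D.IsOverstrand x c ↔ x = o c) (c : D.Crossing) : ¬ D.IsOverstrand c c := by
  intro h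
  refine hred c (Or.inr fun t ht => ?_)
  by_contra! hlt
  obtain ⟨c', rfl | rfl⟩ := D.isPassage_iff.1 ht
  · have h2 : D.IsOverstrand c c' := ⟨D.overTime_mem c', fun d => hlt.trans (h.2 d)⟩
    obtain rfl : c' = c := o.injective (((ho _ _).1 h2).symm.trans ((ho _ _).1 h))
    exact lt_irrefl _ hlt
  · exact lt_asymm hlt (h.2 c')

theorem IsReduced.not_isOverstrand_of_isIncoming (hred : D.IsReduced)
    {o : Equiv.Perm D.Crossing} (ho : ∀ x c, D.IsOverstrand x c ↔ x = o c) {x c : D.Crossing}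
    (hx : D.IsIncoming x c) : ¬ D.IsOverstrand x c := by
  intro h
  refine hred c (Or.inl fun t ht => ?_)
  by_contra! hlt
  have h1 := D.travel_add (D.underTime_mem x) (D.overTime_mem c) (D.underTime_mem c) (h.2 c)
  have h2 := D.travel_add_of_lt (D.underTime_mem x) (D.overTime_mem c) (D.underTime_mem c) ht.1
    (h.2 c) hlt
  obtain ⟨c', rfl | rfl⟩ := D.isPassage_iff.1 ht
  · have h3 : D.IsOverstrand x c' := ⟨D.overTime_mem c', fun d => by linarith [hx d]⟩
    obtain rfl : c' = c := o.injective (((ho _ _).1 h3).symm.trans ((ho _ _).1 h))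
    -- Travel from a parameter to itself counts as a full tour, the maximum.
    exact absurd hlt (D.travel_le_self (D.overTime_mem c') (D.underTime_mem c')).not_gt
  · linarith [hx c']

variable (D)

/-- The coloring matrix at `-1`, in terms of the overstrand and the arriving understrand. -/
theorem foxMatrix_neg_one {R : Type*} [CommRing R] {o q : Equiv.Perm D.Crossing}
    (ho : ∀ x c, D.IsOverstrand x c ↔ x = o c) (hq : ∀ x c, D.IsIncoming x c ↔ x = q c)
    (c x : D.Crossing) :
    D.foxMatrix (-1 : Rˣ) c x =
      2 * (if x = o c then 1 else 0) - (if x = c then 1 else 0) - (if x = q c then 1 else 0) := by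
  classical
  -- At `T = -1` both understrands get the entry `-1`, so left and right no longer matter.
  have hT : LaurentPolynomial.eval₂ (Int.castRingHom R) (-1 : Rˣ) (LaurentPolynomial.T 1) = -1 := by
    rw [LaurentPolynomial.eval₂_T]; simp
  simp only [foxMatrix, Matrix.map_apply, alexanderMatrix, map_add, apply_ite
    (LaurentPolynomial.eval₂ (Int.castRingHom R) (-1 : Rˣ)), map_sub, map_one, map_neg, map_zero,
    hT, ho, IsLeftUnderstrand, IsRightUnderstrand, IsOutgoing, hq]
  by_cases h : D.RightToLeft c <;> simp only [h, true_and, false_and, not_true, not_false_eq_true,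
    or_false, false_or] <;> split_ifs <;> ring

/-- The equation of a crossing is attached to its overstrand, whose two arrows point to the
understrands there. -/
theorem mem_knotCode_neg_one {F : Type*} [Field F] {o q : Equiv.Perm D.Crossing}
    (ho : ∀ x c, D.IsOverstrand x c ↔ x = o c) (hq : ∀ x c, D.IsIncoming x c ↔ x = q c)
    (x : D.Crossing → F) :
    x ∈ D.knotCode (-1 : Fˣ) ↔ IsArrowColoring o.symm (o.symm.trans q) x := by
  have h : ∀ c, (D.foxMatrix (-1 : Fˣ)).mulVec x c = 2 * x (o c) - x c - x (q c) := by
    intro c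
    simp only [Matrix.mulVec, dotProduct, D.foxMatrix_neg_one ho hq]
    simp [sub_mul, Finset.sum_sub_distrib]
  rw [knotCode, LinearMap.mem_ker, Matrix.mulVecLin_apply, funext_iff, IsArrowColoring,
    ← o.symm.forall_congr_right]
  refine forall_congr' fun c => ?_
  rw [h, Pi.zero_apply, Equiv.trans_apply, Equiv.apply_symm_apply, sub_sub, sub_eq_zero]

end KnotDiagram

/-! ### Elementary ideals and specialization at `-1`. -/

theorem map_elementaryIdeal {R S ι κ : Type*} [CommRing R] [CommRing S] [Fintype κ] (k : ℕ)
    (A : Matrix ι κ R) (φ : R →+* S) :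
    (elementaryIdeal k A).map φ = elementaryIdeal k (A.map φ) := by
  rw [elementaryIdeal, elementaryIdeal, Ideal.map_span]
  congr 1
  ext d
  constructor
  · rintro ⟨_, ⟨f, g, rfl⟩, rfl⟩
    exact ⟨f, g, by rw [RingHom.map_det]; rfl⟩
  · rintro ⟨f, g, rfl⟩
    exact ⟨_, ⟨f, g, rfl⟩, by rw [RingHom.map_det]; rfl⟩

theorem elementaryIdeal_submatrix_equiv {R ι ι' κ : Type*} [CommRing R] [Fintype κ] (k : ℕ)
    (A : Matrix ι κ R) (e : ι' ≃ ι) :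
    elementaryIdeal k (A.submatrix e id) = elementaryIdeal k A := by
  rw [elementaryIdeal, elementaryIdeal]
  congr 1
  ext d
  constructor
  · rintro ⟨f, g, rfl⟩
    exact ⟨f.trans e.toEmbedding, g, rfl⟩
  · rintro ⟨f, g, rfl⟩
    refine ⟨f.trans e.symm.toEmbedding, g, ?_⟩
    congr 1
    ext i j
    simp

namespace KnotDiagram

variable {D : KnotDiagram}

theorem IsAlexanderPolynomial.elementaryIdeal_foxMatrix {Δ : ℤ[X]}
    (hΔ : D.IsAlexanderPolynomial Δ) :
    elementaryIdeal 1 (D.foxMatrix (-1 : ℤˣ)) = Ideal.span {Δ.eval (-1)} := by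
  rw [foxMatrix, ← map_elementaryIdeal, ← hΔ.2, Ideal.map_span, Set.image_singleton,
    LaurentPolynomial.eval₂_toLaurent]
  rfl

theorem foxMatrix_submatrix_eq_arrowMatrix {o q : Equiv.Perm D.Crossing}
    (ho : ∀ x c, D.IsOverstrand x c ↔ x = o c) (hq : ∀ x c, D.IsIncoming x c ↔ x = q c) :
    (D.foxMatrix (-1 : ℤˣ)).submatrix o.symm id = arrowMatrix o.symm (o.symm.trans q) := by
  ext v x
  simp only [Matrix.submatrix_apply, D.foxMatrix_neg_one ho hq, arrowMatrix,
    Equiv.apply_symm_apply, Equiv.trans_apply, id]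
  rfl

end KnotDiagram

/-! ### Code parameters and the main theorem. -/

section Code

/-- The parameters of a linear code that contains the constant words and some other word, and in
which every non-constant word has pairwise distinct entries. -/
theorem isCode_of_injective {F ι : Type*} [Field F] [DecidableEq F] [Fintype ι]
    (C : Submodule F (ι → F)) (hcard : 1 < Fintype.card ι) (hconst : (fun _ => 1) ∈ C)
    (hne : ∃ x ∈ C, ∃ a b, x a ≠ x b)
    (hinj : ∀ x ∈ C, (∃ a b, x a ≠ x b) → Function.Injective x) :
    IsCode C (Fintype.card ι) 2 (Fintype.card ι - 1) := by
  classical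
  obtain ⟨i, k, hik⟩ := Fintype.one_lt_card_iff.1 hcard
  obtain ⟨x, hxC, hx⟩ := hne
  have hxinj := hinj x hxC hx
  -- Two zeros force a word to be constant. Hence evaluation at two places is injective, and nonzero
  -- words have weight at least the length minus one.
  have hzero : ∀ y ∈ C, ∀ a b, a ≠ b → y a = 0 → y b = 0 → y = 0 := by
    intro y hy a b hab ha hb
    by_contra h0
    obtain ⟨c, hc⟩ := Function.ne_iff.1 h0
    exact hab (hinj y hy ⟨c, a, by rw [ha]; exact hc⟩ (ha.trans hb.symm))
  refine ⟨rfl, ?_, ?_⟩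
  · let φ : C →ₗ[F] (Fin 2 → F) :=
      LinearMap.pi ![LinearMap.proj i ∘ₗ C.subtype, LinearMap.proj k ∘ₗ C.subtype]
    have h0 : ∀ y, φ y 0 = y.1 i := fun y => rfl
    have h1 : ∀ y, φ y 1 = y.1 k := fun y => rfl
    have hφi : Function.Injective φ := by
      rw [injective_iff_map_eq_zero]
      intro y hy
      exact Subtype.ext (hzero y.1 y.2 i k hik ((h0 y).symm.trans (congrFun hy 0))
        ((h1 y).symm.trans (congrFun hy 1)))
    have hφs : Function.Surjective φ := by
      intro z
      have hd : x i - x k ≠ 0 := sub_ne_zero.2 fun h => hik (hxinj h)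
      let s := (z 0 - z 1) / (x i - x k)
      refine ⟨s • ⟨x, hxC⟩ + (z 0 - s * x i) • ⟨fun _ => 1, hconst⟩, ?_⟩
      have hs : s * (x i - x k) = z 0 - z 1 := div_mul_cancel₀ _ hd
      ext j
      fin_cases j
      · change s * x i + (z 0 - s * x i) * 1 = z 0
        ring
      · change s * x k + (z 0 - s * x i) * 1 = z 1
        linear_combination -hs
    rw [(LinearEquiv.ofBijective φ ⟨hφi, hφs⟩).finrank_eq]
    simp
  · have hnorm : ∀ y : ι → F, hammingNorm y + (Finset.univ.filter fun a => y a = 0).card =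
        Fintype.card ι := by
      intro y
      rw [add_comm]
      exact Finset.card_filter_add_card_filter_not _
    apply le_antisymm
    · obtain ⟨y, hyC, hyi, hy0⟩ : ∃ y ∈ C, y i = 0 ∧ y ≠ 0 := by
        refine ⟨x - x i • fun _ => 1, C.sub_mem hxC (C.smul_mem _ hconst), by simp, fun h => ?_⟩
        have := congrFun h k
        simp only [Pi.sub_apply, Pi.smul_apply, smul_eq_mul, mul_one, Pi.zero_apply] at this
        exact hik (hxinj (sub_eq_zero.1 this).symm)
      refine (iInf₂_le_of_le _ hyC (iInf_le _ hy0)).trans ?_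
      have h1 := hnorm y
      have h2 : 0 < (Finset.univ.filter fun a => y a = 0).card :=
        Finset.card_pos.2 ⟨i, by simp [hyi]⟩
      exact_mod_cast (by omega : hammingNorm y ≤ _)
    · refine le_iInf fun y => le_iInf fun hy => le_iInf fun hy0 => ?_
      have h1 := hnorm y
      have h2 : (Finset.univ.filter fun a => y a = 0).card ≤ 1 := by
        rw [Finset.card_le_one]
        intro a ha b hb
        by_contra hab
        exact hy0 (hzero y hy a b hab (by simpa using ha) (by simpa using hb))
      exact_mod_cast (by omega : _ ≤ hammingNorm y)

end Code

theorem mainTheorem10 (D : KnotDiagram) (hred : D.IsReduced) (halt : D.IsAlternating)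
    (n : ℕ) (hn : Fintype.card D.Strand = n)
    (Δ : Polynomial ℤ) (hΔ : D.IsAlexanderPolynomial Δ)
    (p : ℕ) [Fact p.Prime] (hdet : |Δ.eval (-1)| = (p : ℤ)) :
    IsCode (D.knotCode (-1 : (ZMod p)ˣ)) n 2 (n - 1) ∧
      IsMDS (D.knotCode (-1 : (ZMod p)ˣ)) := by
  subst hn
  have hp : p.Prime := Fact.out
  obtain ⟨o, ho⟩ := halt.exists_overstrand_equiv
  obtain ⟨q, hq⟩ := D.exists_incoming_equiv
  have hspan : elementaryIdeal 1 (arrowMatrix o.symm (o.symm.trans q)) =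
      Ideal.span {(p : ℤ)} := by
    rw [← KnotDiagram.foxMatrix_submatrix_eq_arrowMatrix ho hq, elementaryIdeal_submatrix_equiv,
      hΔ.elementaryIdeal_foxMatrix, ← hdet, Ideal.span_singleton_eq_span_singleton]
    exact Int.associated_iff_natAbs.2 (Int.natAbs_abs _).symm
  have hpos : 0 < Fintype.card D.Crossing := by
    by_contra h0
    -- Without crossings the truncated size `0 - 1` is `0`, and the empty minor `1` would make `p` a
    -- unit.
    have h1 : (1 : ℤ) ∈ elementaryIdeal 1 (arrowMatrix o.symm (o.symm.trans q)) := by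
      have : IsEmpty (Fin (Fintype.card D.Crossing - 1)) :=
        ⟨fun i => by have := i.2; omega⟩
      exact Ideal.subset_span ⟨Function.Embedding.ofIsEmpty, Function.Embedding.ofIsEmpty,
        Matrix.det_isEmpty.symm⟩
    rw [hspan, Ideal.mem_span_singleton] at h1
    exact hp.one_lt.ne' (by exact_mod_cast Int.eq_one_of_dvd_one (by positivity) h1)
  have hm : Fintype.card D.Crossing = Fintype.card D.Crossing - 1 + 1 := by omega
  have hα : ∀ v, o.symm v ≠ v := fun v h =>
    hred.not_isOverstrand_self ho v ((ho v v).2 ((Equiv.symm_apply_eq o).1 h))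
  have hβ : ∀ v, o.symm.trans q v ≠ v := fun v h =>
    hred.not_isOverstrand_of_isIncoming ho ((hq v (o.symm v)).2 h.symm)
      ((ho v (o.symm v)).2 (by simp))
  have hcode : IsCode (D.knotCode (-1 : (ZMod p)ˣ)) (Fintype.card D.Crossing) 2
      (Fintype.card D.Crossing - 1) := by
    obtain ⟨x, hx, hxA⟩ := exists_nonconstant_of_span_minors (p := p) hm _
      (arrowMatrix_col_sum o.symm (o.symm.trans q)) hspan
    refine isCode_of_injective _ ?_ ?_ ⟨x, ?_, hx⟩ fun y hy hne => ?_
    · obtain ⟨a, b, hab⟩ := hx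
      exact Fintype.one_lt_card_iff.2 ⟨a, b, fun h => hab (congrArg x h)⟩
    · rw [D.mem_knotCode_neg_one ho hq]
      intro v
      norm_num
    · rw [D.mem_knotCode_neg_one ho hq]
      intro v
      have := hxA v
      rw [arrowMatrix_mulVec] at this
      linear_combination this
    · exact ((D.mem_knotCode_neg_one ho hq y).1 hy).injective hm hspan hα hβ hne
  refine ⟨hcode, ?_⟩
  rw [IsMDS, hcode.2.1, hcode.2.2]
  exact_mod_cast (by omega : 2 + (Fintype.card D.Crossing - 1) = Fintype.card D.Crossing + 1)
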